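/- Let $\mathbb{T}$ be the unit circle with normalized Lebesgue measure, and let $H^2$ be the closed subspace of $L^2=L^2(\mathbb{T})$ consisting of the functions whose Fourier coefficients of negative index all vanish. For $\varphi\in L^\infty(\mathbb{T})$, let $T_\varphi:H^2\to H^2$ be the Toeplitz operator $T_\varphi f=\mathbb{P}_+(\varphi f)$, where $\mathbb{P}_+$ is the orthogonal projection of $L^2$ onto $H^2$. Suppose that $h\in H^2$, that $h\neq 0$ almost everywhere on $\mathbb{T}$ (so that $1/h$ is defined almost everywhere), and that $1/h\in H^2$. Then the Toeplitz operator $T_{\bar h/h}$ has trivial kernel and dense range. In particular, if $T_{\bar h/h}$ is Fredholm, then $T_{\bar h/h}$ is invertible (i.e. it is a bijection of $H^2$ with bounded inverse). -/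

import Mathlib

open MeasureTheory AddCircle ComplexConjugate
open scoped ENNReal

namespace HardyToeplitz

noncomputable section

/-- Normalized Lebesgue measure on the unit circle. The circle is parametrized by
`t ∈ ℝ / ℤ`, `ζ = exp (2 π i t)`, so that `fourier n t = ζ ^ n`. -/
abbrev circleMeasure : Measure UnitAddCircle := haarAddCircle

/-- `L²` of the unit circle. -/
abbrev CircleL2 : Type := Lp ℂ 2 circleMeasure

/-- A function on the circle (up to null sets) belongs to the Hardy space `H²`: it is square
integrable and its Fourier coefficients of negative index vanish. -/
def MemH2 (f : UnitAddCircle → ℂ) : Prop :=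
  MemLp f 2 circleMeasure ∧ ∀ n : ℤ, n < 0 → fourierCoeff f n = 0

/-- The Hardy space `H²`, as a subspace of `L²` of the circle. -/
def H2 : Submodule ℂ CircleL2 where
  carrier := {f | MemH2 f}
  zero_mem' := ⟨Lp.memLp _, fun n _ => by rw [← fourierBasis_repr]; simp⟩
  add_mem' := fun {f g} hf hg => ⟨Lp.memLp _, fun n hn => by
    rw [← fourierBasis_repr, map_add, lp.coeFn_add, Pi.add_apply, fourierBasis_repr,
      fourierBasis_repr, hf.2 n hn, hg.2 n hn, add_zero]⟩
  smul_mem' := fun c f hf => ⟨Lp.memLp _, fun n hn => by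
    rw [← fourierBasis_repr, map_smul, lp.coeFn_smul, Pi.smul_apply, fourierBasis_repr,
      hf.2 n hn, smul_zero]⟩

theorem isClosed_H2 : IsClosed (H2 : Set CircleL2) := by
  have h : (H2 : Set CircleL2) =
      ⋂ n : ℤ, ⋂ _ : n < 0, {f : CircleL2 | inner ℂ (fourierBasis n : CircleL2) f = 0} := by
    ext f
    simp only [Set.mem_iInter, Set.mem_ofPred_eq]
    constructor
    · intro hf n hn
      rw [← HilbertBasis.repr_apply_apply, fourierBasis_repr]
      exact hf.2 n hn
    · intro hf
      refine ⟨Lp.memLp f, fun n hn => ?_⟩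
      rw [← fourierBasis_repr, HilbertBasis.repr_apply_apply]
      exact hf n hn
  rw [h]
  exact isClosed_iInter fun n => isClosed_iInter fun _ =>
    isClosed_eq (continuous_const.inner continuous_id) continuous_const

instance instCompleteSpaceH2 : CompleteSpace H2 := isClosed_H2.completeSpace_coe

/-- Multiplication by a bounded function `φ`, as an operator on `L²`. -/
def mulOp (φ : Lp ℂ ∞ circleMeasure) : CircleL2 →L[ℂ] CircleL2 :=
  (ContinuousLinearMap.mul ℂ ℂ).holderL circleMeasure ∞ 2 2 φ

/-- The Toeplitz operator `T_φ : H² → H²`, `f ↦ P₊ (φ f)`, where `P₊` is the orthogonal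
projection of `L²` onto `H²`. -/
def toeplitz (φ : Lp ℂ ∞ circleMeasure) : H2 →L[ℂ] H2 :=
  H2.orthogonalProjectionOnto ∘L mulOp φ ∘L H2.subtypeL

/-- For `h ∈ H²`, the function `h̄ / h` is bounded. -/
theorem MemH2.memLp_conj_div {h : UnitAddCircle → ℂ} (hh : MemH2 h) :
    MemLp (fun t => conj (h t) / h t) ∞ circleMeasure := by
  have hm := hh.1.1.aemeasurable
  refine memLp_top_of_bound (C := 1) ?_ (.of_forall fun t => ?_)
  · exact ((Complex.continuous_conj.measurable.comp_aemeasurable hm).div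
      hm).aestronglyMeasurable
  · rw [norm_div, RCLike.norm_conj]
    exact div_self_le_one _

end

end HardyToeplitz

/-!
A product of two `H²` functions has no Fourier coefficients of negative index, and the product of
a conjugated `H²` function with a function orthogonal to `H²` has none of nonnegative index. A
function of both kinds is integrable with vanishing Fourier coefficients, hence zero.

Suppose that `φ ū = u` for some `u ∈ H²` which is almost everywhere nonzero. If `T_φ f = 0`, then
`φ f` is orthogonal to `H²`, and `u f = ū (φ f)` is of both kinds; thus `f = 0`. For `φ = h̄ / h`
this applies to `T_φ` with `u = 1 / h`, and to its adjoint, which has symbol `h / h̄`, with `u = h`.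
-/

open Filter Topology
open scoped NNReal BoundedContinuousFunction InnerProductSpace

section Uniqueness

variable {X E : Type*} [TopologicalSpace X] [MeasurableSpace X] [BorelSpace X]
  [NormedAddCommGroup E] {μ : Measure X} {f : X → E}

theorem tendsto_integral_apprSeq_smul [NormedSpace ℝ E] [HasOuterApproxClosed X]
    (hf : Integrable f μ) {s : Set X} (hs : IsClosed s) :
    Tendsto (fun n => ∫ x, (hs.apprSeq n x : ℝ) • f x ∂μ) atTop (𝓝 (∫ x in s, f x ∂μ)) := by
  rw [← integral_indicator hs.measurableSet]
  refine tendsto_integral_of_dominated_convergence (fun x => ‖f x‖) (fun n => ?_) hf.norm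
    (fun n => .of_forall fun x => ?_) (.of_forall fun x => ?_)
  · have h_cont : Continuous fun x => (hs.apprSeq n x : ℝ) := by fun_prop
    exact h_cont.aestronglyMeasurable.smul hf.1
  · rw [norm_smul, Real.norm_of_nonneg (NNReal.coe_nonneg _)]
    exact mul_le_of_le_one_left (norm_nonneg _)
      (mod_cast HasOuterApproxClosed.apprSeq_apply_le_one hs n x)
  · have h_appr := tendsto_pi_nhds.1 (HasOuterApproxClosed.tendsto_apprSeq hs) x
    have h_smul := (NNReal.tendsto_coe.2 h_appr).smul_const (f x)
    by_cases hx : x ∈ s <;> simpa [hx] using h_smul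

theorem ae_eq_zero_of_forall_integral_boundedContinuous_smul_eq_zero [NormedSpace ℝ E]
    [CompleteSpace E] [HasOuterApproxClosed X] (hf : Integrable f μ)
    (h : ∀ g : X →ᵇ ℝ≥0, ∫ x, (g x : ℝ) • f x ∂μ = 0) : f =ᵐ[μ] 0 :=
  ae_eq_zero_of_forall_setIntegral_isClosed_eq_zero hf fun _ hs =>
    tendsto_nhds_unique (tendsto_integral_apprSeq_smul hf hs) <| by
      simp only [h, tendsto_const_nhds]

theorem integral_smul_eq_zero_of_topologicalClosure_span_eq_top {𝕜 : Type*} [RCLike 𝕜]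
    [NormedSpace ℝ E] [NormedSpace 𝕜 E] [SMulCommClass ℝ 𝕜 E] [CompleteSpace E] [CompactSpace X]
    [IsFiniteMeasure μ] {s : Set C(X, 𝕜)}
    (hs : (Submodule.span 𝕜 s).topologicalClosure = ⊤) (hf : Integrable f μ)
    (h : ∀ g ∈ s, ∫ x, g x • f x ∂μ = 0) (g : C(X, 𝕜)) : ∫ x, g x • f x ∂μ = 0 := by
  let L : C(X, 𝕜) →L[𝕜] E :=
    ((ContinuousLinearMap.lsmul 𝕜 𝕜).lpPairing μ ∞ 1).flip (hf.toL1 f) ∘L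
      ContinuousMap.toLp ∞ μ 𝕜
  have hL (g : C(X, 𝕜)) : L g = ∫ x, g x • f x ∂μ := by
    refine (ContinuousLinearMap.lpPairing_eq_integral _ _ _).trans (integral_congr_ae ?_)
    filter_upwards [ContinuousMap.coeFn_toLp (p := ∞) μ (𝕜 := 𝕜) g, hf.coeFn_toL1] with x hgx hfx
    rw [ContinuousLinearMap.lsmul_apply, hfx]
    exact congrArg (· • f x) hgx
  have h_span : Submodule.span 𝕜 s ≤ L.ker :=
    Submodule.span_le.2 fun g hg => (hL g).trans (h g hg)
  have h_ker : (⊤ : Submodule 𝕜 C(X, 𝕜)) ≤ L.ker :=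
    hs ▸ Submodule.topologicalClosure_minimal _ h_span L.isClosed_ker
  exact (hL g).symm.trans (h_ker Submodule.mem_top)

end Uniqueness

section FourierCoeff

variable {T : ℝ} [Fact (0 < T)]

theorem ae_eq_zero_of_fourierCoeff_eq_zero {E : Type*} [NormedAddCommGroup E] [NormedSpace ℂ E]
    [CompleteSpace E] {f : AddCircle T → E} (hf : Integrable f haarAddCircle)
    (h : ∀ n, fourierCoeff f n = 0) : f =ᵐ[haarAddCircle] 0 := by
  have h_cont := integral_smul_eq_zero_of_topologicalClosure_span_eq_top
    (span_fourier_closure_eq_top (T := T)) hf <| by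
      rintro _ ⟨n, rfl⟩
      simpa only [fourierCoeff, neg_neg] using h (-n)
  refine ae_eq_zero_of_forall_integral_boundedContinuous_smul_eq_zero hf fun g => ?_
  have h_zero := h_cont ⟨fun t => ((g t : ℝ) : ℂ), by fun_prop⟩
  simpa only [ContinuousMap.coe_mk, Complex.coe_smul] using h_zero

theorem fourierCoeff_conj (f : AddCircle T → ℂ) (n : ℤ) :
    fourierCoeff (fun t => conj (f t)) n = conj (fourierCoeff f (-n)) := by
  simp only [fourierCoeff, ← integral_conj, smul_eq_mul, map_mul, fourier_neg, neg_neg]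

theorem fourierCoeff_fourier_smul {E : Type*} [NormedAddCommGroup E] [NormedSpace ℂ E]
    (f : AddCircle T → E) (m n : ℤ) :
    fourierCoeff (fun t => fourier m t • f t) n = fourierCoeff f (n - m) := by
  simp only [fourierCoeff, smul_smul, ← fourier_add, neg_sub, neg_add_eq_sub]

theorem inner_fourierBasis (f : Lp ℂ 2 (haarAddCircle (T := T))) (n : ℤ) :
    ⟪(fourierBasis n : Lp ℂ 2 (haarAddCircle (T := T))), f⟫_ℂ = fourierCoeff f n := by
  rw [← HilbertBasis.repr_apply_apply, fourierBasis_repr]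

theorem hasSum_conj_fourierCoeff_mul_fourierCoeff {f g : AddCircle T → ℂ}
    (hf : MemLp f 2 haarAddCircle) (hg : MemLp g 2 haarAddCircle) :
    HasSum (fun n => conj (fourierCoeff f n) * fourierCoeff g n)
      (∫ t, conj (f t) * g t ∂haarAddCircle) := by
  have h_inner : ⟪hf.toLp f, hg.toLp g⟫_ℂ = ∫ t, conj (f t) * g t ∂haarAddCircle := by
    rw [L2.inner_def]
    refine integral_congr_ae ?_
    filter_upwards [hf.coeFn_toLp, hg.coeFn_toLp] with t hft hgt
    rw [hft, hgt, RCLike.inner_apply']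
  rw [← h_inner, ← fourierCoeff_congr_ae hf.coeFn_toLp, ← fourierCoeff_congr_ae hg.coeFn_toLp]
  simpa only [inner_fourierBasis, ← inner_conj_symm (hf.toLp f)] using
    fourierBasis.hasSum_inner_mul_inner (hf.toLp f) (hg.toLp g)

theorem hasSum_fourierCoeff_sub_mul_fourierCoeff {f g : AddCircle T → ℂ}
    (hf : MemLp f 2 haarAddCircle) (hg : MemLp g 2 haarAddCircle) (n : ℤ) :
    HasSum (fun k => fourierCoeff f (n - k) * fourierCoeff g k)
      (fourierCoeff (fun t => f t * g t) n) := by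
  let F : AddCircle T → ℂ := fun t => conj (fourier (-n) t • f t)
  have h_fourier : MemLp (fourier (-n)) ∞ (haarAddCircle (T := T)) :=
    (BoundedContinuousFunction.mkOfCompact (fourier (-n))).memLp_top
  have hF : MemLp F 2 haarAddCircle := (hf.smul h_fourier).star
  have hF_coeff (k : ℤ) : conj (fourierCoeff F k) = fourierCoeff f (n - k) := by
    rw [fourierCoeff_conj, Complex.conj_conj, fourierCoeff_fourier_smul, sub_neg_eq_add,
      neg_add_eq_sub]
  have hF_integral : ∫ t, conj (F t) * g t ∂haarAddCircle =
      fourierCoeff (fun t => f t * g t) n := by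
    simp only [F, Complex.conj_conj, fourierCoeff, smul_eq_mul, mul_assoc]
  simpa only [hF_coeff, hF_integral] using
    hasSum_conj_fourierCoeff_mul_fourierCoeff hF hg

theorem fourierCoeff_mul_eq_zero {f g : AddCircle T → ℂ} (hf : MemLp f 2 haarAddCircle)
    (hg : MemLp g 2 haarAddCircle) {n : ℤ}
    (h : ∀ k, fourierCoeff f (n - k) = 0 ∨ fourierCoeff g k = 0) :
    fourierCoeff (fun t => f t * g t) n = 0 := by
  rw [← (hasSum_fourierCoeff_sub_mul_fourierCoeff hf hg n).tsum_eq]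
  simp only [mul_eq_zero.2 (h _), tsum_zero]

end FourierCoeff

section Operators

variable {𝕜 E F : Type*}

theorem isInvertible_of_ker_eq_bot_of_denseRange [NontriviallyNormedField 𝕜]
    [NormedAddCommGroup E] [NormedSpace 𝕜 E] [CompleteSpace E]
    [NormedAddCommGroup F] [NormedSpace 𝕜 F] [CompleteSpace F] {A : E →L[𝕜] F}
    (h_ker : A.ker = ⊥) (h_dense : DenseRange A) (h_closed : IsClosed (A.range : Set F)) :
    A.IsInvertible :=
  have h_range : A.range = ⊤ := SetLike.coe_injective <| by
    simpa only [LinearMap.coe_range, Submodule.top_coe] using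
      h_closed.closure_eq.symm.trans h_dense.closure_eq
  ⟨.ofBijective A h_ker h_range, ContinuousLinearEquiv.coe_ofBijective A h_ker h_range⟩

theorem denseRange_iff_ker_adjoint_eq_bot [RCLike 𝕜]
    [NormedAddCommGroup E] [InnerProductSpace 𝕜 E] [CompleteSpace E]
    [NormedAddCommGroup F] [InnerProductSpace 𝕜 F] [CompleteSpace F] (A : E →L[𝕜] F) :
    DenseRange A ↔ (A.adjoint).ker = ⊥ := by
  rw [← ContinuousLinearMap.orthogonal_range, ← Submodule.topologicalClosure_eq_top_iff,
    ← Submodule.dense_iff_topologicalClosure_eq_top]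
  rfl

end Operators

namespace HardyToeplitz

theorem coeFn_mulOp (φ : Lp ℂ ∞ circleMeasure) (f : CircleL2) :
    mulOp φ f =ᵐ[circleMeasure] fun t => φ t * f t :=
  ContinuousLinearMap.coeFn_holder (ContinuousLinearMap.mul ℂ ℂ) φ f

theorem adjoint_mulOp (φ : Lp ℂ ∞ circleMeasure) : (mulOp φ).adjoint = mulOp (star φ) := by
  refine ((ContinuousLinearMap.eq_adjoint_iff _ _).2 fun f g => ?_).symm
  rw [L2.inner_def, L2.inner_def]
  refine integral_congr_ae ?_
  filter_upwards [coeFn_mulOp (star φ) f, coeFn_mulOp φ g, Lp.coeFn_star φ] with t hf hg hφ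
  rw [hf, hg, hφ, Pi.star_apply, RCLike.inner_apply', RCLike.inner_apply', map_mul,
    RCLike.star_def, Complex.conj_conj]
  ring

theorem adjoint_toeplitz (φ : Lp ℂ ∞ circleMeasure) :
    (toeplitz φ).adjoint = toeplitz (star φ) := by
  rw [toeplitz, ContinuousLinearMap.adjoint_comp, ContinuousLinearMap.adjoint_comp,
    Submodule.adjoint_subtypeL, Submodule.adjoint_orthogonalProjectionOnto, adjoint_mulOp]
  rfl

theorem fourierBasis_mem_H2 {n : ℤ} (hn : 0 ≤ n) : (fourierBasis n : CircleL2) ∈ H2 := by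
  refine ⟨Lp.memLp _, fun k hk => ?_⟩
  rw [← inner_fourierBasis]
  exact fourierBasis.orthonormal.2 (by omega)

theorem fourierCoeff_eq_zero_of_mem_H2_orthogonal {f : CircleL2} (hf : f ∈ H2ᗮ) {n : ℤ}
    (hn : 0 ≤ n) : fourierCoeff f n = 0 := by
  rw [← inner_fourierBasis]
  exact hf _ (fourierBasis_mem_H2 hn)

theorem MemH2.fourierCoeff_conj_eq_zero {f : UnitAddCircle → ℂ} (hf : MemH2 f) {n : ℤ}
    (hn : 0 < n) : fourierCoeff (fun t => conj (f t)) n = 0 := by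
  rw [fourierCoeff_conj, hf.2 _ (neg_neg_of_pos hn), map_zero]

theorem mul_ae_eq_zero_of_ae_eq_conj_mul {u v f : UnitAddCircle → ℂ} {w : CircleL2}
    (hu : MemH2 u) (hf : MemH2 f) (hv : MemH2 v) (hw : w ∈ H2ᗮ)
    (h : (fun t => u t * f t) =ᵐ[circleMeasure] fun t => conj (v t) * w t) :
    (fun t => u t * f t) =ᵐ[circleMeasure] 0 := by
  refine ae_eq_zero_of_fourierCoeff_eq_zero (hu.1.integrable_mul hf.1) fun n => ?_
  rcases lt_or_ge n 0 with hn | hn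
  · refine fourierCoeff_mul_eq_zero hu.1 hf.1 fun k => ?_
    exact (lt_or_ge k 0).symm.imp (fun hk => hu.2 _ (by omega)) (hf.2 k)
  · rw [fourierCoeff_congr_ae h]
    refine fourierCoeff_mul_eq_zero hv.1.star (Lp.memLp w) fun k => ?_
    exact (lt_or_ge k 0).imp (fun hk => hv.fourierCoeff_conj_eq_zero (by omega))
      (fourierCoeff_eq_zero_of_mem_H2_orthogonal hw)

theorem ker_toeplitz_eq_bot {φ : Lp ℂ ∞ circleMeasure} {u : UnitAddCircle → ℂ} (hu : MemH2 u)
    (hu_ne : ∀ᵐ t ∂circleMeasure, u t ≠ 0)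
    (hφ : ∀ᵐ t ∂circleMeasure, φ t * conj (u t) = u t) : (toeplitz φ).ker = ⊥ := by
  refine (Submodule.eq_bot_iff _).2 fun f hf => ?_
  have h_orth : mulOp φ f ∈ H2ᗮ := Submodule.orthogonalProjectionOnto_eq_zero_iff.1 hf
  have h_eq : (fun t => u t * (f : CircleL2) t) =ᵐ[circleMeasure]
      fun t => conj (u t) * mulOp φ f t := by
    filter_upwards [coeFn_mulOp φ f, hφ] with t ht hφt
    rw [ht, ← mul_assoc, mul_comm (conj _), hφt]
  refine Subtype.ext (Lp.eq_zero_iff_ae_eq_zero.2 ?_)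
  filter_upwards [mul_ae_eq_zero_of_ae_eq_conj_mul hu f.2 hu h_orth h_eq, hu_ne] with t ht hne
  exact (mul_eq_zero.1 ht).resolve_left hne

variable {h : UnitAddCircle → ℂ}

theorem ker_toeplitz_conj_div_eq_bot (hh : MemH2 h) (h_ne : ∀ᵐ t ∂circleMeasure, h t ≠ 0)
    (h_inv : MemH2 (fun t => 1 / h t)) : (toeplitz hh.memLp_conj_div.toLp).ker = ⊥ := by
  refine ker_toeplitz_eq_bot h_inv (h_ne.mono fun t => one_div_ne_zero) ?_
  filter_upwards [hh.memLp_conj_div.coeFn_toLp, h_ne] with t hφ hne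
  have h_conj_ne : conj (h t) ≠ 0 := (map_ne_zero _).2 hne
  rw [hφ, map_div₀, map_one]
  field_simp

theorem denseRange_toeplitz_conj_div (hh : MemH2 h) (h_ne : ∀ᵐ t ∂circleMeasure, h t ≠ 0) :
    DenseRange (toeplitz hh.memLp_conj_div.toLp) := by
  rw [denseRange_iff_ker_adjoint_eq_bot, adjoint_toeplitz]
  refine ker_toeplitz_eq_bot hh h_ne ?_
  filter_upwards [Lp.coeFn_star hh.memLp_conj_div.toLp, hh.memLp_conj_div.coeFn_toLp, h_ne]
    with t h_star hφ hne
  have h_conj_ne : conj (h t) ≠ 0 := (map_ne_zero _).2 hne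
  rw [h_star, Pi.star_apply, hφ, RCLike.star_def, map_div₀, Complex.conj_conj,
    div_mul_cancel₀ _ h_conj_ne]

end HardyToeplitz

theorem mainTheorem9 (h : UnitAddCircle → ℂ)
    (hh : HardyToeplitz.MemH2 h)
    (h_ne : ∀ᵐ t ∂HardyToeplitz.circleMeasure, h t ≠ 0)
    (h_inv : HardyToeplitz.MemH2 (fun t => 1 / h t)) :
    (HardyToeplitz.toeplitz hh.memLp_conj_div.toLp).ker = ⊥ ∧
      DenseRange (HardyToeplitz.toeplitz hh.memLp_conj_div.toLp) ∧
      ((HardyToeplitz.toeplitz hh.memLp_conj_div.toLp).IsFredholm →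
        (HardyToeplitz.toeplitz hh.memLp_conj_div.toLp).IsInvertible) := by
  have h_ker := HardyToeplitz.ker_toeplitz_conj_div_eq_bot hh h_ne h_inv
  have h_dense := HardyToeplitz.denseRange_toeplitz_conj_div hh h_ne
  exact ⟨h_ker, h_dense, fun h_fredholm =>
    isInvertible_of_ker_eq_bot_of_denseRange h_ker h_dense h_fredholm.isClosed_range⟩
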